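/- All graphs are finite and simple. A clique of a graph \(G\) is a maximal complete subgraph of \(G\), and the clique graph \(K(G)\) is the intersection graph of the cliques of \(G\): its vertices are the cliques of \(G\), and two distinct cliques are adjacent if and only if they have a vertex in common. The iterated clique graphs are defined by \(K^0(G)=G\) and \(K^{n}(G)=K(K^{n-1}(G))\) for \(n\ge 1\). The graph \(G\) is called convergent if the graphs \(K^n(G)\), \(n\ge 0\), fall into finitely many isomorphism types, and divergent otherwise. The octahedron is the complete tripartite graph \(K_{2,2,2}\). Theorem. Let \(G\) be a connected graph that is not isomorphic to the octahedron. If the maximum degree of \(G\) satisfies \(\Delta(G)\le 4\), then \(G\) is convergent. Equivalently, if \(G\) is divergent, then \(G\) has a vertex of degree at least \(5\). -/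

import Mathlib

universe u

/-- The cliques of `G`: the maximal complete subgraphs, given by their vertex sets. -/
abbrev MaxClique {V : Type u} (G : SimpleGraph V) : Type u :=
  {q : Set V // Maximal (fun s : Set V => G.IsClique s) q}

/-- The clique graph `K(G)`: the intersection graph of the cliques of `G`. -/
def cliqueGraph {V : Type u} (G : SimpleGraph V) : SimpleGraph (MaxClique G) where
  Adj q r := q ≠ r ∧ (q.1 ∩ r.1).Nonempty
  symm := ⟨fun _ _ h => ⟨h.1.symm, by rw [Set.inter_comm]; exact h.2⟩⟩
  loopless := ⟨fun _ h => h.1 rfl⟩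

/-- The iterated clique graphs, bundled with their vertex types:
`K⁰(G) = G` and `Kⁿ⁺¹(G) = K(Kⁿ(G))`. -/
def iterCliqueGraph {V : Type u} (G : SimpleGraph V) : ℕ → Σ W : Type u, SimpleGraph W
  | 0 => ⟨V, G⟩
  | n + 1 => ⟨MaxClique (iterCliqueGraph G n).2, cliqueGraph (iterCliqueGraph G n).2⟩

/-- `G` is convergent: up to isomorphism, its iterated clique graphs form a finite set. -/
def CliqueConvergent {V : Type u} (G : SimpleGraph V) : Prop :=
  ∃ F : Set (Σ W : Type u, SimpleGraph W), F.Finite ∧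
    ∀ n : ℕ, ∃ H ∈ F, Nonempty ((iterCliqueGraph G n).2 ≃g H.2)

/-- `G` is divergent: it is not convergent. -/
def CliqueDivergent {V : Type u} (G : SimpleGraph V) : Prop :=
  ¬ CliqueConvergent G

/-- The graph of the octahedron: three pairs of opposite vertices, two vertices being adjacent
exactly when they belong to different pairs. -/
def octahedronGraph : SimpleGraph (Fin 3 × Fin 2) where
  Adj x y := x.1 ≠ y.1
  symm := ⟨fun _ _ h => h.symm⟩
  loopless := ⟨fun _ h => h rfl⟩

/-! A clique of the clique graph of a Helly graph is the star of a vertex. Hence taking clique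
graphs preserves the Helly property and taking them twice does not increase the order, so a graph is
convergent once one of its iterates is Helly (`cliqueConvergent_of_helly`). Under the hypotheses the
second clique graph is already Helly. With degrees at most four, a clique of K(G) that is not a star
is the necktie of an inner triangle `a b c`, whose closed neighbourhood is an octahedron, perhaps
lacking edges of the outer face `x y z` (`eq_star_or_eq_necktie`). A complete outer face would make
G the octahedron by connectedness, so it never occurs. This excluded face drives the case analysis:
neckties meet as soon as a suitable edge lies in both octahedra (`necktie_meet_of_adj`), and meeting
neckties are twins or belong to opposite faces (`twin_or_opposite`). By Gilmore's criterion, the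
Helly property of K²(G) need only be tested on triangles of K²(G), that is, on three pairwise
meeting stars or neckties. For each such triple one complete set of cliques meets everything that
meets two of the three (`cone_of_meet`). -/

namespace LowDegree

variable {V : Type u} {G : SimpleGraph V}

/-! ### Helly graphs, their iterates, and Gilmore's criterion. -/

section

/-- A graph is Helly if every nonempty family of pairwise intersecting cliques has a common
vertex. -/
def Helly (G : SimpleGraph V) : Prop :=
  ∀ F : Set (MaxClique G), F.Nonempty → (∀ q ∈ F, ∀ r ∈ F, (q.1 ∩ r.1).Nonempty) →
    ∃ v, ∀ q ∈ F, v ∈ q.1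

theorem exists_maxClique [Finite V] {s : Set V} (hs : G.IsClique s) :
    ∃ q : MaxClique G, s ⊆ q.1 := by
  obtain ⟨q, hq, hm⟩ := (Set.toFinite {s : Set V | G.IsClique s}).exists_le_maximal hs
  exact ⟨⟨q, hm⟩, hq⟩

theorem MaxClique.nonempty [Nonempty V] (q : MaxClique G) : q.1.Nonempty := by
  by_contra h
  rw [Set.not_nonempty_iff_eq_empty] at h
  obtain ⟨v⟩ := ‹Nonempty V›
  have := q.2.2 (y := {v}) (by simp) (by rw [h]; simp)
  exact (h ▸ this rfl : v ∈ (∅ : Set V))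

theorem MaxClique.mem_of_forall (q : MaxClique G) {v : V}
    (h : ∀ w ∈ q.1, v = w ∨ G.Adj v w) : v ∈ q.1 := by
  have := q.2.2 (y := insert v q.1)
    (SimpleGraph.isClique_insert.2 ⟨q.2.1, fun w hw hne => (h w hw).resolve_left hne⟩)
    (Set.subset_insert _ _)
  exact this (Set.mem_insert _ _)

theorem MaxClique.adj (q : MaxClique G) {v w : V} (hv : v ∈ q.1) (hw : w ∈ q.1) :
    v = w ∨ G.Adj v w :=
  or_iff_not_imp_left.2 fun h => q.2.1 hv hw h

/-- The cliques that contain a given vertex. -/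
def star (G : SimpleGraph V) (v : V) : Set (MaxClique G) := {q | v ∈ q.1}

theorem isClique_of_meet {F : Set (MaxClique G)}
    (h : ∀ q ∈ F, ∀ r ∈ F, (q.1 ∩ r.1).Nonempty) : (cliqueGraph G).IsClique F :=
  fun q hq r hr hne => ⟨hne, h q hq r hr⟩

theorem isClique_star (v : V) : (cliqueGraph G).IsClique (star G v) :=
  isClique_of_meet fun _ hq _ hr => ⟨v, hq, hr⟩

theorem meet_of_isClique [Nonempty V] (A : MaxClique (cliqueGraph G)) {q r : MaxClique G}
    (hq : q ∈ A.1) (hr : r ∈ A.1) : (q.1 ∩ r.1).Nonempty := by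
  rcases MaxClique.adj A hq hr with rfl | h
  · simpa using MaxClique.nonempty q
  · exact h.2

theorem MaxClique.eq_of_subset (q : MaxClique G) {s : Set V} (hs : G.IsClique s) (h : q.1 ⊆ s) :
    q.1 = s :=
  h.antisymm (q.2.2 hs h)

instance [Nonempty V] [Finite V] : Nonempty (MaxClique G) :=
  (exists_maxClique (G := G) (s := ∅) (by simp)).nonempty

theorem Helly.exists_eq_star [Nonempty V] [Finite V] (hG : Helly G)
    (A : MaxClique (cliqueGraph G)) : ∃ v, A.1 = star G v := by
  obtain ⟨v, hv⟩ := hG A.1 (MaxClique.nonempty A) fun q hq r hr => meet_of_isClique A hq hr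
  exact ⟨v, MaxClique.eq_of_subset A (isClique_star v) hv⟩

/-- Give each clique of K(G) a centre. Two of them that meet share a clique of G, so their centres
are equal or adjacent. The centres of the family thus lie in one clique of G, which belongs to every
star involved. -/
theorem Helly.cliqueGraph [Nonempty V] [Finite V] (hG : Helly G) : Helly (cliqueGraph G) := by
  intro F _ hF
  choose f hf using hG.exists_eq_star
  obtain ⟨q, hq⟩ := exists_maxClique (G := G) (s := f '' F) (by
    rintro _ ⟨A, hA, rfl⟩ _ ⟨B, hB, rfl⟩ hne
    obtain ⟨q, h1, h2⟩ := hF A hA B hB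
    rw [hf] at h1 h2
    exact q.2.1 h1 h2 hne)
  refine ⟨q, fun A hA => ?_⟩
  rw [hf]
  exact hq ⟨A, hA, rfl⟩

theorem Helly.card_le [Nonempty V] [Finite V] (hG : Helly G) :
    Nat.card (MaxClique (_root_.cliqueGraph G)) ≤ Nat.card V := by
  choose f hf using hG.exists_eq_star
  refine Nat.card_le_card_of_injective f fun A B h => Subtype.ext ?_
  rw [hf A, hf B, h]

theorem finite_nonempty_iter [Nonempty V] [Finite V] (n : ℕ) :
    Nonempty (iterCliqueGraph G n).1 ∧ Finite (iterCliqueGraph G n).1 := by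
  induction n with
  | zero => exact ⟨‹_›, ‹_›⟩
  | succ n ih =>
    obtain ⟨_, _⟩ := ih
    exact ⟨inferInstanceAs (Nonempty (MaxClique _)), inferInstanceAs (Finite (MaxClique _))⟩

theorem cliqueConvergent_of_card_le [Finite V] [Nonempty V] {M : ℕ}
    (h : ∀ n, Nat.card (iterCliqueGraph G n).1 ≤ M) : CliqueConvergent G := by
  -- There are finitely many graphs on `Fin m` with `m ≤ M`; `ULift` only moves them to the universe
  -- of `V`.
  refine ⟨Set.range fun p : (Σ m : Fin (M + 1), SimpleGraph (ULift.{u} (Fin m))) =>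
    ⟨ULift.{u} (Fin p.1), p.2⟩, Set.finite_range _, fun n => ?_⟩
  obtain ⟨_, _⟩ := finite_nonempty_iter (G := G) n
  let e : ULift.{u} (Fin (Nat.card (iterCliqueGraph G n).1)) ≃ (iterCliqueGraph G n).1 :=
    Equiv.ulift.trans (Finite.equivFin _).symm
  exact ⟨_, ⟨⟨⟨_, Nat.lt_succ_of_le (h n)⟩, (iterCliqueGraph G n).2.comap e⟩, rfl⟩,
    ⟨(SimpleGraph.Iso.comap e _).symm⟩⟩

theorem cliqueConvergent_of_helly [Finite V] [Nonempty V] {k : ℕ}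
    (h : Helly (iterCliqueGraph G k).2) : CliqueConvergent G := by
  have hH : ∀ n, Helly (iterCliqueGraph G (k + n)).2 := by
    intro n
    induction n with
    | zero => exact h
    | succ n ih =>
      obtain ⟨_, _⟩ := finite_nonempty_iter (G := G) (k + n)
      exact ih.cliqueGraph
  let c : ℕ → ℕ := fun n => Nat.card (iterCliqueGraph G n).1
  have hc : ∀ n, c (k + n + 2) ≤ c (k + n) := by
    intro n
    obtain ⟨_, _⟩ := finite_nonempty_iter (G := G) (k + n)
    exact (hH n).card_le
  -- The bound on orders advances by two, so both `k` and `k + 1` are needed to start the two parity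
  -- classes.
  obtain ⟨M, hM⟩ : ∃ M, ∀ n ≤ k + 1, c n ≤ M :=
    ⟨(Finset.range (k + 2)).sup c, fun n hn => Finset.le_sup (by simp; omega)⟩
  refine cliqueConvergent_of_card_le (M := M) fun n => ?_
  change c n ≤ M
  induction n using Nat.strong_induction_on with
  | _ n ih =>
    by_cases hn : n ≤ k + 1
    · exact hM n hn
    · obtain ⟨m, rfl⟩ : ∃ m, n = k + m + 2 := ⟨n - k - 2, by omega⟩
      exact (hc m).trans (ih _ (by omega))

/-- Two of the three points lie in the set. -/
def TwoOf {α : Type*} (a b c : α) (s : Set α) : Prop :=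
  (b ∈ s ∧ c ∈ s) ∨ (c ∈ s ∧ a ∈ s) ∨ (a ∈ s ∧ b ∈ s)

/-- A criterion of Gilmore for a common point of a pairwise intersecting family. -/
theorem exists_common_of_twoOf {α : Type*} (F : Finset (Set α)) (hne : F.Nonempty)
    (hF : ∀ s ∈ F, ∀ t ∈ F, (s ∩ t).Nonempty)
    (h : ∀ a b c, (∃ s ∈ F, b ∈ s ∧ c ∈ s) → (∃ s ∈ F, c ∈ s ∧ a ∈ s) →
      (∃ s ∈ F, a ∈ s ∧ b ∈ s) → ∃ u, ∀ s ∈ F, TwoOf a b c s → u ∈ s) :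
    ∃ u, ∀ s ∈ F, u ∈ s := by
  classical
  induction hn : F.card using Nat.strong_induction_on generalizing F with
  | _ n ih =>
  by_cases h3 : 2 < F.card
  · obtain ⟨r, s, t, hr, hs, ht, hrs, hrt, hst⟩ := Finset.two_lt_card_iff.1 h3
    have key : ∀ r ∈ F, ∃ u, ∀ s ∈ F, s ≠ r → u ∈ s := by
      intro r hr
      have hc := Finset.card_erase_of_mem hr
      obtain ⟨u, hu⟩ := ih (F.erase r).card (by omega) (F.erase r)
        (Finset.card_pos.1 (by omega))
        (fun s hs t ht => hF s (Finset.mem_of_mem_erase hs) t (Finset.mem_of_mem_erase ht))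
        (fun a b c ha hb hc => by
          obtain ⟨u, hu⟩ := h a b c
            (ha.imp fun s hs => ⟨Finset.mem_of_mem_erase hs.1, hs.2⟩)
            (hb.imp fun s hs => ⟨Finset.mem_of_mem_erase hs.1, hs.2⟩)
            (hc.imp fun s hs => ⟨Finset.mem_of_mem_erase hs.1, hs.2⟩)
          exact ⟨u, fun s hs => hu s (Finset.mem_of_mem_erase hs)⟩) rfl
      exact ⟨u, fun s hs hne => hu s (Finset.mem_erase.2 ⟨hne, hs⟩)⟩
    obtain ⟨a, ha⟩ := key r hr
    obtain ⟨b, hb⟩ := key s hs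
    obtain ⟨c, hc⟩ := key t ht
    -- Each of `a`, `b`, `c` may miss only `r`, `s`, `t` respectively, so every member of `F`
    -- contains two of them.
    obtain ⟨u, hu⟩ := h a b c ⟨r, hr, hb r hr hrs, hc r hr hrt⟩
      ⟨s, hs, hc s hs hst, ha s hs hrs.symm⟩ ⟨t, ht, ha t ht hrt.symm, hb t ht hst.symm⟩
    refine ⟨u, fun q hq => hu q hq ?_⟩
    unfold TwoOf
    by_cases h1 : q = r
    · subst h1; exact .inl ⟨hb _ hq hrs, hc _ hq hrt⟩
    · by_cases h2 : q = s
      · subst h2; exact .inr (.inl ⟨hc _ hq hst, ha _ hq h1⟩)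
      · exact .inr (.inr ⟨ha _ hq h1, hb _ hq h2⟩)
  · obtain ⟨s, hs⟩ := hne
    by_cases h1 : ∃ t ∈ F, t ≠ s
    · obtain ⟨t, ht, hts⟩ := h1
      obtain ⟨u, hu⟩ := hF s hs t ht
      refine ⟨u, fun q hq => ?_⟩
      by_contra hcon
      exact h3 (Finset.two_lt_card_iff.2 ⟨q, s, t, hq, hs, ht,
        fun e => hcon (e ▸ hu.1), fun e => hcon (e ▸ hu.2), hts.symm⟩)
    · push Not at h1
      obtain ⟨u, hu⟩ := hF s hs s hs
      exact ⟨u, fun q hq => h1 q hq ▸ hu.1⟩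

/-- Points sharing a clique are equal or adjacent, and if two of the three coincide, that point
already serves. So Gilmore's condition is needed for triangles only. -/
theorem exists_common_maxClique [Finite V] (F : Set (MaxClique G)) (hne : F.Nonempty)
    (hF : ∀ q ∈ F, ∀ r ∈ F, (q.1 ∩ r.1).Nonempty)
    (h : ∀ a b c, G.Adj b c → G.Adj c a → G.Adj a b →
      ∃ u, ∀ q ∈ F, TwoOf a b c q.1 → u ∈ q.1) :
    ∃ u, ∀ q ∈ F, u ∈ q.1 := by
  classical
  have hfin : (Subtype.val '' F : Set (Set V)).Finite := Set.toFinite _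
  obtain ⟨u, hu⟩ := exists_common_of_twoOf hfin.toFinset
    (by simpa using hne)
    (by
      simp only [Set.Finite.mem_toFinset]
      rintro _ ⟨q, hq, rfl⟩ _ ⟨r, hr, rfl⟩
      exact hF q hq r hr)
    (by
      simp only [Set.Finite.mem_toFinset]
      rintro a b c ⟨_, ⟨q, hq, rfl⟩, hq1, hq2⟩ ⟨_, ⟨r, hr, rfl⟩, hr1, hr2⟩
        ⟨_, ⟨s, hs, rfl⟩, hs1, hs2⟩
      suffices ∃ u, ∀ q ∈ F, TwoOf a b c q.1 → u ∈ q.1 by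
        obtain ⟨u, hu⟩ := this
        exact ⟨u, by rintro _ ⟨q, hq, rfl⟩; exact hu q hq⟩
      rcases MaxClique.adj q hq1 hq2 with rfl | h1
      · exact ⟨b, fun q hq => by unfold TwoOf; tauto⟩
      rcases MaxClique.adj r hr1 hr2 with rfl | h2
      · exact ⟨c, fun q hq => by unfold TwoOf; tauto⟩
      rcases MaxClique.adj s hs1 hs2 with rfl | h3
      · exact ⟨a, fun q hq => by unfold TwoOf; tauto⟩
      exact h a b c h1 h2 h3)
  exact ⟨u, fun q hq => hu q.1 (by simpa using ⟨q.2, hq⟩)⟩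

end

/-! ### Inner triangles, their octahedra and their neckties. -/

section

/-- The triangle `a b c` is the centre of an octahedron with opposite vertices `x y z`, some of
whose edges among `x y z` may be missing, and whose central vertices have no other neighbours. -/
structure Inner (G : SimpleGraph V) (a b c x y z : V) : Prop where
  adj_a : ∀ u, G.Adj a u ↔ u = b ∨ u = c ∨ u = y ∨ u = z
  adj_b : ∀ u, G.Adj b u ↔ u = c ∨ u = a ∨ u = z ∨ u = x
  adj_c : ∀ u, G.Adj c u ↔ u = a ∨ u = b ∨ u = x ∨ u = y
  ne_a : a ≠ x
  ne_b : b ≠ y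
  ne_c : c ≠ z
  ne_xy : x ≠ y
  ne_yz : y ≠ z
  ne_zx : z ≠ x

/-- The vertices of the octahedron around an inner triangle. -/
def hull (a b c x y z : V) : Set V := {u | u = a ∨ u = b ∨ u = c ∨ u = x ∨ u = y ∨ u = z}

/-- The cliques that contain an edge of the triangle `a b c`. -/
def necktie (G : SimpleGraph V) (a b c : V) : Set (MaxClique G) := {q | TwoOf a b c q.1}

variable {a b c x y z a' b' c' x' y' z' u v w : V}

theorem Inner.rot (h : Inner G a b c x y z) : Inner G b c a y z x :=
  ⟨h.adj_b, h.adj_c, h.adj_a, h.ne_b, h.ne_c, h.ne_a, h.ne_yz, h.ne_zx, h.ne_xy⟩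

theorem Inner.swap (h : Inner G a b c x y z) : Inner G a c b x z y :=
  ⟨fun u => (h.adj_a u).trans (by tauto), fun u => (h.adj_c u).trans (by tauto),
    fun u => (h.adj_b u).trans (by tauto), h.ne_a, h.ne_c, h.ne_b, h.ne_zx.symm, h.ne_yz.symm,
    h.ne_xy.symm⟩

theorem Inner.adjs (h : Inner G a b c x y z) :
    G.Adj a b ∧ G.Adj b c ∧ G.Adj c a ∧ G.Adj b x ∧ G.Adj c x ∧ G.Adj c y ∧ G.Adj a y ∧
      G.Adj a z ∧ G.Adj b z := by
  simp [h.adj_a, h.adj_b, h.adj_c]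

theorem necktie_rot : necktie G b c a = necktie G a b c := by
  ext q; simp only [necktie, TwoOf, Set.mem_ofPred_eq]; tauto

theorem necktie_swap : necktie G a c b = necktie G a b c := by
  ext q; simp only [necktie, TwoOf, Set.mem_ofPred_eq]; tauto

theorem hull_rot : hull b c a y z x = hull a b c x y z := by
  ext q; simp only [hull, Set.mem_ofPred_eq]; tauto

theorem exists_maxClique_three [Finite V] (h1 : u = v ∨ G.Adj u v) (h2 : v = w ∨ G.Adj v w)
    (h3 : u = w ∨ G.Adj u w) : ∃ q : MaxClique G, u ∈ q.1 ∧ v ∈ q.1 ∧ w ∈ q.1 := by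
  obtain ⟨q, hq⟩ := exists_maxClique (G := G) (s := {u, v, w}) (by
    have := G.symm.symm
    rintro p hp r hr hne
    simp only [Set.mem_insert_iff, Set.mem_singleton_iff] at hp hr
    grind)
  exact ⟨q, hq (by simp), hq (by simp), hq (by simp)⟩

theorem mem_hull_of_necktie (h : Inner G a b c x y z) {q : MaxClique G}
    (hq : q ∈ necktie G a b c) (hu : u ∈ q.1) : u ∈ hull a b c x y z := by
  have := h.adj_a u
  have := h.adj_b u
  have := h.adj_c u
  have := fun v hv => MaxClique.adj q (v := v) hv hu
  simp only [necktie, TwoOf, hull, Set.mem_ofPred_eq] at *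
  grind

theorem star_meet_star [Finite V] :
    (star G v ∩ star G w).Nonempty ↔ v = w ∨ G.Adj v w := by
  constructor
  · rintro ⟨q, hv, hw⟩
    exact MaxClique.adj q hv hw
  · intro h
    obtain ⟨q, h1, h2, -⟩ := exists_maxClique_three (G := G) (u := v) (v := w) (w := w) h
      (.inl rfl) h
    exact ⟨q, h1, h2⟩

/-- Each vertex of the hull lies in a common clique with an edge of `a b c`: `x` and `a` with `b c`,
and so on. This turns meeting questions in K(G) into membership in the hull. -/
theorem star_meet_necktie [Finite V] (h : Inner G a b c x y z) :
    (star G v ∩ necktie G a b c).Nonempty ↔ v ∈ hull a b c x y z := by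
  constructor
  · rintro ⟨q, hv, hq⟩
    exact mem_hull_of_necktie h hq hv
  · intro hv
    have hab := (h.adj_a b).2
    have hbc := (h.adj_b c).2
    have hca := (h.adj_c a).2
    have ha := (h.adj_a v).2
    have hb := (h.adj_b v).2
    have hc := (h.adj_c v).2
    have hs := fun u v => G.adj_comm u v
    simp only [hull, Set.mem_ofPred_eq] at hv
    by_cases hx : v = x ∨ v = a
    · obtain ⟨q, h1, h2, h3⟩ := exists_maxClique_three (G := G) (u := v) (v := b) (w := c)
        (by grind) (by grind) (by grind)
      exact ⟨q, h1, .inl ⟨h2, h3⟩⟩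
    by_cases hx : v = y ∨ v = b
    · obtain ⟨q, h1, h2, h3⟩ := exists_maxClique_three (G := G) (u := v) (v := c) (w := a)
        (by grind) (by grind) (by grind)
      exact ⟨q, h1, .inr (.inl ⟨h2, h3⟩)⟩
    · obtain ⟨q, h1, h2, h3⟩ := exists_maxClique_three (G := G) (u := v) (v := a) (w := b)
        (by grind) (by grind) (by grind)
      exact ⟨q, h1, .inr (.inr ⟨h2, h3⟩)⟩

theorem necktie_meet_of_three [Finite V] (h1 : u = v ∨ G.Adj u v) (h2 : v = w ∨ G.Adj v w)
    (h3 : u = w ∨ G.Adj u w) (h : TwoOf a b c {u, v, w}) (h' : TwoOf a' b' c' {u, v, w}) :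
    (necktie G a b c ∩ necktie G a' b' c').Nonempty := by
  obtain ⟨q, hu, hv, hw⟩ := exists_maxClique_three h1 h2 h3
  have hs : ({u, v, w} : Set V) ⊆ q.1 := by rintro _ (rfl | rfl | rfl) <;> assumption
  exact ⟨q, h.imp (.imp (@hs _) (@hs _)) (.imp (.imp (@hs _) (@hs _)) (.imp (@hs _) (@hs _))),
    h'.imp (.imp (@hs _) (@hs _)) (.imp (.imp (@hs _) (@hs _)) (.imp (@hs _) (@hs _)))⟩

theorem exists_face_aux (h : Inner G a b c x y z)
    (h' : Inner G a' b' c' x' y' z') (hO : ¬ (G.Adj x y ∧ G.Adj y z ∧ G.Adj z x))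
    (hv : a = a' ∨ a = x') (hw : w = b ∨ w = y) (hw' : w = b' ∨ w = y') :
    ∃ u v w, G.Adj u v ∧ G.Adj v w ∧ G.Adj u w ∧ TwoOf a b c {u, v, w} ∧
      TwoOf a' b' c' {u, v, w} := by
  have hs := fun u v => G.adj_comm u v
  have hir := fun v => G.irrefl (v := v)
  obtain ⟨i1, i2, i3, i4, i5, i6, i7, i8, i9⟩ := h.adjs
  obtain ⟨j1, j2, j3, j4, j5, j6, j7, j8, j9⟩ := h'.adjs
  obtain ⟨h1, h2, h3, h4, h5, h6, h7, h8, h9⟩ := h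
  obtain ⟨h1', h2', h3', h4', h5', h6', h7', h8', h9'⟩ := h'
  -- `c'` is a common neighbour of `a` and `w`, which leaves two candidates. Where the second gives
  -- no suitable face, it forces `x y z` to be a triangle, against `hO`.
  have hc : c' = c ∨ c' = z := by
    have k1 : G.Adj a c' := by rcases hv with rfl | rfl <;> grind
    have k2 : G.Adj w c' := by rcases hw' with rfl | rfl <;> grind
    have := k1.ne
    have := k2.ne
    have := i2.ne
    have := i6.ne
    rcases hw with rfl | rfl
    · rcases (h1 c').1 k1 with rfl | rfl | rfl | rfl <;> grind
    · rcases (h1 c').1 k1 with rfl | rfl | rfl | rfl <;> grind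
  simp only [TwoOf, Set.mem_insert_iff, Set.mem_singleton_iff]
  rcases hv with rfl | rfl <;> rcases hw with rfl | rfl <;> rcases hw' with rfl | rfl
  · exact ⟨a, w, c, by grind⟩
  · exact ⟨a, w, c', by grind⟩
  · exact ⟨a, w, c, by grind⟩
  · rcases hc with rfl | rfl
    · exact ⟨a, w, c', by grind⟩
    · exact ⟨a, b, c', by grind⟩
  · exact ⟨a, w, c', by grind⟩
  · rcases hc with rfl | rfl
    · exact ⟨x, w, c', by grind⟩
    · exfalso; grind
  · rcases hc with rfl | rfl
    · exact ⟨a, w, c', by grind⟩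
    · exfalso; grind
  · rcases hc with rfl | rfl
    · exact ⟨a, b, c', by grind⟩
    · exfalso; grind

end

/-! ### The cliques of K(G) when degrees are at most four. -/

section
variable {a b c x y z a' b' c' x' y' z' p u v w : V}

/-- No octahedron around an inner triangle is complete. -/
def OctahedronFree (G : SimpleGraph V) : Prop :=
  ∀ ⦃a b c x y z : V⦄, Inner G a b c x y z → ¬ (G.Adj x y ∧ G.Adj y z ∧ G.Adj z x)

/-- Every vertex with four distinct neighbours has no further neighbour. -/
def DegreeLeFour (G : SimpleGraph V) : Prop :=
  ∀ ⦃v p q r s : V⦄, G.Adj v p → G.Adj v q → G.Adj v r → G.Adj v s → p ≠ q → p ≠ r → p ≠ s →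
    q ≠ r → q ≠ s → r ≠ s → ∀ u, G.Adj v u ↔ u = p ∨ u = q ∨ u = r ∨ u = s

theorem degreeLeFour_of_maxDegree [Fintype V] [DecidableRel G.Adj] (h : G.maxDegree ≤ 4) :
    DegreeLeFour G := by
  classical
  intro v p q r s hp hq hr hs h1 h2 h3 h4 h5 h6 u
  constructor
  · intro hu
    by_contra hcon
    push Not at hcon
    obtain ⟨k1, k2, k3, k4⟩ := hcon
    have hsub : ({u, p, q, r, s} : Finset V) ⊆ G.neighborFinset v := by
      intro t ht
      simp only [Finset.mem_insert, Finset.mem_singleton] at ht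
      rw [SimpleGraph.mem_neighborFinset]
      rcases ht with rfl | rfl | rfl | rfl | rfl <;> assumption
    have hc := Finset.card_le_card hsub
    rw [SimpleGraph.card_neighborFinset_eq_degree] at hc
    have hd := (G.degree_le_maxDegree v).trans h
    rw [Finset.card_insert_of_notMem (by simp [*]), Finset.card_insert_of_notMem (by simp [*]),
      Finset.card_insert_of_notMem (by simp [*]), Finset.card_insert_of_notMem (by simp [*]),
      Finset.card_singleton] at hc
    omega
  · rintro (rfl | rfl | rfl | rfl) <;> assumption

/-- The three non-adjacencies make `x`, `y`, `z` distinct, so each of `a`, `b`, `c` has four known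
neighbours and the degree bound permits no others. -/
theorem DegreeLeFour.inner (hG : DegreeLeFour G) (hab : G.Adj a b) (hbc : G.Adj b c)
    (hca : G.Adj c a) (hxb : G.Adj x b) (hxc : G.Adj x c) (hyc : G.Adj y c) (hya : G.Adj y a)
    (hza : G.Adj z a) (hzb : G.Adj z b) (hx : ¬ G.Adj x a) (hy : ¬ G.Adj y b)
    (hz : ¬ G.Adj z c) (hax : x ≠ a) (hby : y ≠ b) (hcz : z ≠ c) : Inner G a b c x y z where
  adj_a := hG hab hca.symm hya.symm hza.symm hbc.ne hby.symm hzb.ne.symm hyc.ne.symm hcz.symm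
    fun e => hz (e ▸ hyc)
  adj_b := hG hbc hab.symm hzb.symm hxb.symm hca.ne hcz.symm hxc.ne.symm hza.ne.symm hax.symm
    fun e => hx (e ▸ hza)
  adj_c := hG hca hbc.symm hxc.symm hyc.symm hab.ne hax.symm hya.ne.symm hxb.ne.symm hby.symm
    fun e => hy (e ▸ hxb)
  ne_a := hax.symm
  ne_b := hby.symm
  ne_c := hcz.symm
  ne_xy := fun e => hx (e ▸ hya)
  ne_yz := fun e => hy (e ▸ hzb)
  ne_zx := fun e => hz (e ▸ hxc)

theorem isClique_necktie : (cliqueGraph G).IsClique (necktie G a b c) := by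
  refine isClique_of_meet fun q hq r hr => ?_
  by_cases ha : a ∈ q.1 ∧ a ∈ r.1
  · exact ⟨a, ha⟩
  by_cases hb : b ∈ q.1 ∧ b ∈ r.1
  · exact ⟨b, hb⟩
  refine ⟨c, ?_⟩
  simp only [necktie, TwoOf, Set.mem_ofPred_eq, Set.mem_inter_iff] at *
  tauto

/-- A clique with two of `a`, `b`, `c` that avoids `a` contains `b` and `c`; by maximality it has a
member `x` not adjacent to `a`. Likewise for `y` and `z`. -/
theorem exists_inner_of_twoOf (hG : DegreeLeFour G) {F : Set (MaxClique G)}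
    (hbc : G.Adj b c) (hca : G.Adj c a) (hab : G.Adj a b)
    (hF : ∀ u, ∃ q ∈ F, TwoOf a b c q.1 ∧ u ∉ q.1) :
    ∃ x y z, Inner G a b c x y z ∧ (∃ q ∈ F, b ∈ q.1 ∧ c ∈ q.1 ∧ x ∈ q.1) ∧
      (∃ q ∈ F, c ∈ q.1 ∧ a ∈ q.1 ∧ y ∈ q.1) ∧ (∃ q ∈ F, a ∈ q.1 ∧ b ∈ q.1 ∧ z ∈ q.1) := by
  have key : ∀ u (q : MaxClique G), u ∉ q.1 → ∃ t ∈ q.1, t ≠ u ∧ ¬ G.Adj t u := by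
    intro u q hu
    by_contra hcon
    push Not at hcon
    exact hu (MaxClique.mem_of_forall q fun w hw => or_iff_not_imp_left.2 fun hne =>
      (hcon w hw (Ne.symm hne)).symm)
  obtain ⟨q, hq, hq', ha⟩ := hF a
  obtain ⟨r, hr, hr', hb⟩ := hF b
  obtain ⟨s, hs, hs', hc⟩ := hF c
  obtain ⟨x, hx, hxa, hxa'⟩ := key a q ha
  obtain ⟨y, hy, hyb, hyb'⟩ := key b r hb
  obtain ⟨z, hz, hzc, hzc'⟩ := key c s hc
  unfold TwoOf at hq' hr' hs'
  have hq1 : b ∈ q.1 ∧ c ∈ q.1 := by tauto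
  have hr1 : c ∈ r.1 ∧ a ∈ r.1 := by tauto
  have hs1 : a ∈ s.1 ∧ b ∈ s.1 := by tauto
  have adj : ∀ {q : MaxClique G} {u v w : V}, u ∈ q.1 → v ∈ q.1 → G.Adj v w → ¬ G.Adj u w →
      G.Adj u v := fun hu hv h1 h2 => (MaxClique.adj _ hu hv).resolve_left fun e => h2 (e ▸ h1)
  exact ⟨x, y, z, hG.inner hab hbc hca (adj hx hq1.1 hab.symm hxa') (adj hx hq1.2 hca hxa')
    (adj hy hr1.1 hbc.symm hyb') (adj hy hr1.2 hab hyb') (adj hz hs1.1 hca.symm hzc')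
    (adj hz hs1.2 hbc hzc') hxa' hyb' hzc' hxa hyb hzc, ⟨q, hq, hq1.1, hq1.2, hx⟩,
    ⟨r, hr, hr1.1, hr1.2, hy⟩, ⟨s, hs, hs1.1, hs1.2, hz⟩⟩

variable [Finite V]

theorem necktie_meet_aux₁ (hG : OctahedronFree G) (h : Inner G a b c x y z)
    (h' : Inner G a' b' c' x' y' z') (hv : a = a' ∨ a = x') (hw : w = b ∨ w = y)
    (hw' : w = b' ∨ w = y') : (necktie G a b c ∩ necktie G a' b' c').Nonempty := by
  obtain ⟨u, v, w, h1, h2, h3, h4, h5⟩ := exists_face_aux h h' (hG h) hv hw hw'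
  exact necktie_meet_of_three (.inr h1) (.inr h2) (.inr h3) h4 h5

theorem necktie_meet_aux₂ (hG : OctahedronFree G) (h : Inner G a b c x y z)
    (h' : Inner G a' b' c' x' y' z') (hv : a = a' ∨ a = x') (hw : w = b ∨ w = y)
    (hw' : w ∈ hull a' b' c' x' y' z') : (necktie G a b c ∩ necktie G a' b' c').Nonempty := by
  have haw : G.Adj a w := (h.adj_a w).2 (by tauto)
  -- `a` is one of the antipodes `a'`, `x'`, and its neighbour `w` can be neither of them.
  have key : ¬ (w = a' ∨ w = x') := by
    have h1 := h'.adj_a x'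
    have h2 := h'.adjs
    have h3 := h'.ne_a
    have h4 := h'.ne_xy
    have h5 := h'.ne_zx
    have h6 := G.adj_comm
    have h7 := haw.ne
    have h8 := h2.2.2.2.1.ne
    have h9 := h2.2.2.2.2.1.ne
    grind
  rcases hw' with e | e | e | e | e | e
  · exact absurd (.inl e) key
  · exact necktie_meet_aux₁ hG h h' hv hw (.inl e)
  · rw [← necktie_swap (a := a')]
    exact necktie_meet_aux₁ hG h h'.swap hv hw (.inl e)
  · exact absurd (.inr e) key
  · exact necktie_meet_aux₁ hG h h' hv hw (.inr e)
  · rw [← necktie_swap (a := a')]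
    exact necktie_meet_aux₁ hG h h'.swap hv hw (.inr e)

theorem necktie_meet_aux₃ (hG : OctahedronFree G) (h : Inner G a b c x y z)
    (h' : Inner G a' b' c' x' y' z') (hv : a ∈ hull a' b' c' x' y' z') (hw : w = b ∨ w = y)
    (hw' : w ∈ hull a' b' c' x' y' z') : (necktie G a b c ∩ necktie G a' b' c').Nonempty := by
  by_cases h1 : a = a' ∨ a = x'
  · exact necktie_meet_aux₂ hG h h' h1 hw hw'
  by_cases h2 : a = b' ∨ a = y'
  · rw [← hull_rot] at hw'
    rw [← necktie_rot (a := a')]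
    exact necktie_meet_aux₂ hG h h'.rot h2 hw hw'
  · rw [← hull_rot, ← hull_rot] at hw'
    rw [← necktie_rot (a := a'), ← necktie_rot (a := b')]
    exact necktie_meet_aux₂ hG h h'.rot.rot (by simp only [hull, Set.mem_ofPred_eq] at hv; tauto)
      hw hw'

theorem necktie_meet_aux₄ (hG : OctahedronFree G) (h : Inner G a b c x y z)
    (h' : Inner G a' b' c' x' y' z') (hw : G.Adj a w) (hv' : a ∈ hull a' b' c' x' y' z')
    (hw' : w ∈ hull a' b' c' x' y' z') : (necktie G a b c ∩ necktie G a' b' c').Nonempty := by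
  by_cases h1 : w = b ∨ w = y
  · exact necktie_meet_aux₃ hG h h' hv' h1 hw'
  · rw [← necktie_swap (a := a)]
    exact necktie_meet_aux₃ hG h.swap h' hv' (by rw [h.adj_a] at hw; tauto) hw'

/-- If a vertex of an inner triangle and a neighbour of it both lie in the octahedron around another
inner triangle, then the two neckties have a common clique. -/
theorem necktie_meet_of_adj (hG : OctahedronFree G) (h : Inner G a b c x y z)
    (h' : Inner G a' b' c' x' y' z') (hv : v = a ∨ v = b ∨ v = c) (hw : G.Adj v w)
    (hv' : v ∈ hull a' b' c' x' y' z') (hw' : w ∈ hull a' b' c' x' y' z') :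
    (necktie G a b c ∩ necktie G a' b' c').Nonempty := by
  rcases hv with rfl | rfl | rfl
  · exact necktie_meet_aux₄ hG h h' hw hv' hw'
  · rw [← necktie_rot (a := a)]
    exact necktie_meet_aux₄ hG h.rot h' hw hv' hw'
  · rw [← necktie_rot, ← necktie_rot]
    exact necktie_meet_aux₄ hG h.rot.rot h' hw hv' hw'

/-- The cliques of the clique graph are stars and neckties of inner triangles. -/
theorem eq_star_or_eq_necktie [Nonempty V] (hG : DegreeLeFour G) (hO : OctahedronFree G)
    (A : MaxClique (cliqueGraph G)) :
    (∃ v, A.1 = star G v) ∨ ∃ a b c x y z, Inner G a b c x y z ∧ A.1 = necktie G a b c := by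
  rw [or_iff_not_imp_left]
  intro hA
  have hA' : ¬ ∃ v, ∀ q ∈ A.1, v ∈ q.1 := fun ⟨v, hv⟩ =>
    hA ⟨v, MaxClique.eq_of_subset A (isClique_star v) hv⟩
  have hex := mt (exists_common_maxClique A.1 (MaxClique.nonempty A)
    fun q hq r hr => meet_of_isClique A hq hr) hA'
  push Not at hex
  obtain ⟨a, b, c, hbc, hca, hab, hF⟩ := hex
  obtain ⟨x, y, z, h, ⟨q, hq, hqb, hqc, hqx⟩, ⟨r, hr, hrc, hra, hry⟩, ⟨s, hs, hsa, hsb, hsz⟩⟩ :=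
    exists_inner_of_twoOf hG hbc hca hab hF
  refine ⟨a, b, c, x, y, z, h, MaxClique.eq_of_subset A isClique_necktie fun t ht => ?_⟩
  -- A clique containing `b`, `c`, `x` has no further member, so `t`, which meets it, contains one
  -- of the three.
  have sub : ∀ {a b c x y z : V} {q : MaxClique G}, Inner G a b c x y z → q ∈ A.1 → b ∈ q.1 →
      c ∈ q.1 → x ∈ q.1 → b ∈ t.1 ∨ c ∈ t.1 ∨ x ∈ t.1 := by
    intro a b c x y z q h hq hb hc hx
    obtain ⟨u, hu, hut⟩ := meet_of_isClique A hq ht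
    have h1 := MaxClique.adj q hb hu
    have h2 := MaxClique.adj q hc hu
    have h3 := MaxClique.adj q hx hu
    have e1 := h.adj_b u
    have e2 := h.adj_c u
    have e3 := h.adj_a x
    obtain ⟨i1, i2, i3, i4, i5, i6, i7, i8, i9⟩ := h.adjs
    obtain ⟨h1, h2, h3, h4, h5, h6, h7, h8, h9⟩ := h
    have := G.adj_comm
    have := i4.ne
    have := i5.ne
    have := i9.ne
    have := i2.ne
    suffices u = b ∨ u = c ∨ u = x by grind
    grind
  have s1 := sub h hq hqb hqc hqx
  have s2 := sub h.rot hr hrc hra hry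
  have s3 := sub h.rot.rot hs hsa hsb hsz
  -- `t` hits the three faces next to `a b c` and contains no antipodal pair. With at most one of
  -- `a`, `b`, `c` in `t`, it would contain an antipodal pair or all of `x`, `y`, `z`.
  have d1 := fun (h1 : a ∈ t.1) (h2 : x ∈ t.1) => MaxClique.adj t h1 h2
  have d2 := fun (h1 : b ∈ t.1) (h2 : y ∈ t.1) => MaxClique.adj t h1 h2
  have d3 := fun (h1 : c ∈ t.1) (h2 : z ∈ t.1) => MaxClique.adj t h1 h2
  have d4 := fun (h1 : x ∈ t.1) (h2 : y ∈ t.1) => MaxClique.adj t h1 h2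
  have d5 := fun (h1 : y ∈ t.1) (h2 : z ∈ t.1) => MaxClique.adj t h1 h2
  have d6 := fun (h1 : z ∈ t.1) (h2 : x ∈ t.1) => MaxClique.adj t h1 h2
  have hO' := hO h
  obtain ⟨i1, i2, i3, i4, i5, i6, i7, i8, i9⟩ := h.adjs
  have e1 := h.adj_a x
  have e2 := h.adj_b y
  have e3 := h.adj_c z
  obtain ⟨h1, h2, h3, h4, h5, h6, h7, h8, h9⟩ := h
  have := i4.ne
  have := i5.ne
  have := i6.ne
  have := i7.ne
  have := i8.ne
  have := i9.ne
  simp only [necktie, TwoOf, Set.mem_ofPred_eq]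
  grind

end

/-! ### Meeting neckties: twins and opposite faces. -/

section
variable {a b c x y z a' b' c' x' y' z' p q r u v w : V}

/-- Two families of cliques meet the same cliques of the clique graph. -/
def Twin (G : SimpleGraph V) (A A' : Set (MaxClique G)) : Prop :=
  ∀ B : MaxClique (cliqueGraph G), (A ∩ B.1).Nonempty ↔ (A' ∩ B.1).Nonempty

/-- `A` is the necktie of the triangle `c x y`, which shares only the vertex `c` with `a b c`. -/
def Opposite (G : SimpleGraph V) (a b c x y : V) (A : Set (MaxClique G)) : Prop :=
  ∃ p, Inner G c x y p a b ∧ A = necktie G c x y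

theorem Inner.relabel (h : Inner G a b c x y z) (hp : p = a ∨ p = b ∨ p = c)
    (hq : q = a ∨ q = b ∨ q = c) (hr : r = a ∨ r = b ∨ r = c) (hpq : p ≠ q) (hqr : q ≠ r)
    (hrp : r ≠ p) :
    ∃ x' y' z', Inner G p q r x' y' z' ∧ necktie G p q r = necktie G a b c := by
  rcases hp with rfl | rfl | rfl <;> rcases hq with rfl | rfl | rfl <;>
    rcases hr with rfl | rfl | rfl <;> try contradiction
  · exact ⟨_, _, _, h, rfl⟩
  · exact ⟨_, _, _, h.swap, necktie_swap⟩
  · exact ⟨_, _, _, h.rot.swap, by rw [necktie_swap, necktie_rot]⟩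
  · exact ⟨_, _, _, h.rot, necktie_rot⟩
  · exact ⟨_, _, _, h.rot.rot, by rw [necktie_rot, necktie_rot]⟩
  · exact ⟨_, _, _, h.rot.rot.swap, by rw [necktie_swap, necktie_rot, necktie_rot]⟩

theorem Inner.not_adj (h : Inner G a b c x y z) : ¬ G.Adj a x := by
  obtain ⟨-, -, -, i4, i5, -⟩ := h.adjs
  rw [h.adj_a]
  rintro (e | e | e | e)
  · exact i4.ne e.symm
  · exact i5.ne e.symm
  · exact h.ne_xy e
  · exact h.ne_zx e.symm

/-- The neighbours of `b` and `c` are prescribed by both octahedra, so these have the same six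
vertices, with `a` and `x` interchanged. -/
theorem Inner.eq_of_flip (h : Inner G a b c x y z) (h' : Inner G x b c p q r) :
    p = a ∧ q = y ∧ r = z := by
  obtain ⟨i1, i2, i3, i4, i5, i6, i7, i8, i9⟩ := h.adjs
  obtain ⟨j1, j2, j3, j4, j5, j6, j7, j8, j9⟩ := h'.adjs
  have hp : p = a := by
    rcases (h.adj_b p).1 j4 with e | e | e | e
    · exact absurd e.symm j5.ne
    · exact e
    · exact absurd (e ▸ j5) h.rot.rot.not_adj
    · exact absurd e.symm h'.ne_a
  have hq : q = y := by
    rcases (h.adj_c q).1 j6 with e | e | e | e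
    · exact absurd (hp.trans e.symm) h'.ne_xy
    · exact absurd e.symm h'.ne_b
    · exact absurd e.symm j7.ne
    · exact e
  have hr : r = z := by
    rcases (h.adj_b r).1 j9 with e | e | e | e
    · exact absurd e.symm h'.ne_c
    · exact absurd (e.trans hp.symm) h'.ne_zx
    · exact e
    · exact absurd e.symm j8.ne
  exact ⟨hp, hq, hr⟩

theorem Inner.eq_of_opposite (h : Inner G a b c x y z) (h' : Inner G c x y p q r) :
    q = a ∧ r = b := by
  obtain ⟨i1, i2, i3, i4, i5, i6, i7, i8, i9⟩ := h.adjs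
  obtain ⟨j1, j2, j3, j4, j5, j6, j7, j8, j9⟩ := h'.adjs
  have hq : q = a := by
    rcases (h.adj_c q).1 j7 with e | e | e | e
    · exact e
    · exact absurd (e ▸ i4.symm) h'.rot.not_adj
    · exact absurd e.symm h'.ne_b
    · exact absurd e.symm j6.ne
  have hr : r = b := by
    rcases (h.adj_c r).1 j8 with e | e | e | e
    · exact absurd (hq.trans e.symm) h'.ne_yz
    · exact e
    · exact absurd e.symm j9.ne
    · exact absurd e.symm h'.ne_c
  exact ⟨hq, hr⟩

/-- `Q` lies within `a`, `b`, `c`, `x`, and `a`, `x` are not adjacent, so `b'` or `c'` is `b` or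
`c`. Then `a'` is in the hull too, and the second triangle is one of the seven faces other than `x y
z`. -/
theorem common_face_aux (h : Inner G a b c x y z) (h' : Inner G a' b' c' x' y' z')
    {Q : MaxClique G} (hb : b ∈ Q.1) (hc : c ∈ Q.1) (hb' : b' ∈ Q.1) (hc' : c' ∈ Q.1)
    (P : V → Prop) (hP : ∀ u, P u ↔ u = a' ∨ u = b' ∨ u = c') :
    (P a ∧ P b ∧ P c) ∨ (P x ∧ P b ∧ P c) ∨ (P y ∧ P c ∧ P a) ∨ (P z ∧ P a ∧ P b) ∨
      (P c ∧ P x ∧ P y) ∨ (P a ∧ P y ∧ P z) ∨ (P b ∧ P z ∧ P x) := by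
  obtain ⟨i1, i2, i3, i4, i5, i6, i7, i8, i9⟩ := h.adjs
  obtain ⟨j1, j2, j3, j4, j5, j6, j7, j8, j9⟩ := h'.adjs
  have hs := G.adj_comm
  have hax := h.not_adj
  have hby := h.rot.not_adj
  have hcz := h.rot.rot.not_adj
  have key : ∀ u ∈ Q.1, u = b ∨ u = c ∨ u = a ∨ u = x := by
    intro u hu
    have h1 := MaxClique.adj Q hb hu
    have h2 := MaxClique.adj Q hc hu
    rw [h.adj_b] at h1
    rw [h.adj_c] at h2
    have := i6.ne
    have := h.ne_yz
    have := i9.ne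
    grind
  have hB := h.adj_b a'
  have hC := h.adj_c a'
  have hA := h.adj_a a'
  have := h.ne_a
  have := h.ne_b
  have := h.ne_c
  have := j1.ne
  have := j2.ne
  have := j3.ne
  rcases key b' hb' with rfl | rfl | rfl | rfl <;> rcases key c' hc' with rfl | rfl | rfl | rfl <;>
    grind

theorem common_face (h : Inner G a b c x y z) (h' : Inner G a' b' c' x' y' z')
    (hm : (necktie G a b c ∩ necktie G a' b' c').Nonempty)
    (P : V → Prop) (hP : ∀ u, P u ↔ u = a' ∨ u = b' ∨ u = c') :
    (P a ∧ P b ∧ P c) ∨ (P x ∧ P b ∧ P c) ∨ (P y ∧ P c ∧ P a) ∨ (P z ∧ P a ∧ P b) ∨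
      (P c ∧ P x ∧ P y) ∨ (P a ∧ P y ∧ P z) ∨ (P b ∧ P z ∧ P x) := by
  obtain ⟨Q, hQ, hQ'⟩ := hm
  have main : ∀ {a b c x y z : V}, Inner G a b c x y z → b ∈ Q.1 → c ∈ Q.1 →
    (P a ∧ P b ∧ P c) ∨ (P x ∧ P b ∧ P c) ∨ (P y ∧ P c ∧ P a) ∨ (P z ∧ P a ∧ P b) ∨
      (P c ∧ P x ∧ P y) ∨ (P a ∧ P y ∧ P z) ∨ (P b ∧ P z ∧ P x) := by
    intro a b c x y z h hb hc
    rcases hQ' with ⟨h1, h2⟩ | ⟨h1, h2⟩ | ⟨h1, h2⟩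
    · exact common_face_aux h h' hb hc h1 h2 P hP
    · exact common_face_aux h h'.rot hb hc h1 h2 P fun u => (hP u).trans (by tauto)
    · exact common_face_aux h h'.rot.rot hb hc h1 h2 P fun u => (hP u).trans (by tauto)
  rcases hQ with ⟨h1, h2⟩ | ⟨h1, h2⟩ | ⟨h1, h2⟩
  · exact main h h1 h2
  · have := main h.rot h1 h2
    tauto
  · have := main h.rot.rot h1 h2
    tauto

variable [Finite V]

theorem necktie_meet_flip (hO : OctahedronFree G) (h : Inner G x b c a y z)
    (h' : Inner G a' b' c' x' y' z') (hm : (necktie G a b c ∩ necktie G a' b' c').Nonempty) :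
    (necktie G x b c ∩ necktie G a' b' c').Nonempty := by
  obtain ⟨Q, hQ, hQ'⟩ := hm
  obtain ⟨i1, i2, i3, i4, i5, i6, i7, i8, i9⟩ := h.adjs
  rcases hQ with ⟨h1, h2⟩ | ⟨h1, h2⟩ | ⟨h1, h2⟩
  · exact ⟨Q, .inl ⟨h1, h2⟩, hQ'⟩
  · exact necktie_meet_of_adj hO h h' (.inr (.inr rfl)) i5 (mem_hull_of_necktie h' hQ' h1)
      (mem_hull_of_necktie h' hQ' h2)
  · exact necktie_meet_of_adj hO h h' (.inr (.inl rfl)) i4 (mem_hull_of_necktie h' hQ' h2)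
      (mem_hull_of_necktie h' hQ' h1)

/-- The two triangles have the same hull, hence meet the same stars; neckties are transferred by
`necktie_meet_flip`. -/
theorem twin_flip [Nonempty V] (hG : DegreeLeFour G) (hO : OctahedronFree G)
    (h : Inner G a b c x y z) (h' : Inner G x b c a y z) :
    Twin G (necktie G a b c) (necktie G x b c) := by
  intro B
  rcases eq_star_or_eq_necktie hG hO B with ⟨v, hv⟩ | ⟨a', b', c', x', y', z', hT, hB⟩
  · rw [hv, Set.inter_comm, star_meet_necktie h, Set.inter_comm, star_meet_necktie h']
    simp only [hull, Set.mem_ofPred_eq]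
    tauto
  · rw [hB]
    exact ⟨necktie_meet_flip hO h' hT, necktie_meet_flip hO h hT⟩

theorem twin_flip' [Nonempty V] (hG : DegreeLeFour G) (hO : OctahedronFree G)
    (h : Inner G a b c x y z) (h' : Inner G x b c p q r) :
    Twin G (necktie G a b c) (necktie G x b c) := by
  obtain ⟨rfl, rfl, rfl⟩ := h.eq_of_flip h'
  exact twin_flip hG hO h h'

/-- Two neckties with a common clique are twins, or their triangles are opposite at a vertex. -/
theorem twin_or_opposite [Nonempty V] (hG : DegreeLeFour G) (hO : OctahedronFree G)
    (h : Inner G a b c x y z) (h' : Inner G a' b' c' x' y' z')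
    (hm : (necktie G a b c ∩ necktie G a' b' c').Nonempty) :
    Twin G (necktie G a b c) (necktie G a' b' c') ∨
      Opposite G a b c x y (necktie G a' b' c') ∨ Opposite G b c a y z (necktie G a' b' c') ∨
      Opposite G c a b z x (necktie G a' b' c') := by
  obtain ⟨i1, i2, i3, i4, i5, i6, i7, i8, i9⟩ := h.adjs
  have opp : ∀ {a b c x y z : V}, Inner G a b c x y z → (c = a' ∨ c = b' ∨ c = c') →
      (x = a' ∨ x = b' ∨ x = c') → (y = a' ∨ y = b' ∨ y = c') →
      Opposite G a b c x y (necktie G a' b' c') := by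
    intro a b c x y z h h1 h2 h3
    obtain ⟨i1, i2, i3, i4, i5, i6, i7, i8, i9⟩ := h.adjs
    obtain ⟨p, q, r, k, e⟩ := h'.relabel h1 h2 h3 i5.ne h.ne_xy i6.ne.symm
    obtain ⟨rfl, rfl⟩ := h.eq_of_opposite k
    exact ⟨p, k, e.symm⟩
  have tw : ∀ {a b c x y z : V}, Inner G a b c x y z → (x = a' ∨ x = b' ∨ x = c') →
      (b = a' ∨ b = b' ∨ b = c') → (c = a' ∨ c = b' ∨ c = c') →
      Twin G (necktie G a b c) (necktie G a' b' c') := by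
    intro a b c x y z h h1 h2 h3
    obtain ⟨i1, i2, i3, i4, i5, i6, i7, i8, i9⟩ := h.adjs
    obtain ⟨p, q, r, k, e⟩ := h'.relabel h1 h2 h3 i4.ne.symm i2.ne i5.ne
    rw [← e]
    exact twin_flip' hG hO h k
  rcases common_face h h' hm (fun u => u = a' ∨ u = b' ∨ u = c') (fun _ => Iff.rfl) with
    ⟨h1, h2, h3⟩ | ⟨h1, h2, h3⟩ | ⟨h1, h2, h3⟩ | ⟨h1, h2, h3⟩ | ⟨h1, h2, h3⟩ | ⟨h1, h2, h3⟩ |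
    ⟨h1, h2, h3⟩
  · obtain ⟨p, q, r, k, e⟩ := h'.relabel h1 h2 h3 i1.ne i2.ne i3.ne
    exact .inl fun B => by rw [e]
  · exact .inl (tw h h1 h2 h3)
  · left
    rw [← necktie_rot (a := a)]
    exact tw h.rot h1 h2 h3
  · left
    rw [← necktie_rot (a := a), ← necktie_rot (a := b)]
    exact tw h.rot.rot h1 h2 h3
  · exact .inr (.inl (opp h h1 h2 h3))
  · exact .inr (.inr (.inl (opp h.rot h1 h2 h3)))
  · exact .inr (.inr (.inr (opp h.rot.rot h1 h2 h3)))

end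

/-! ### Cones over triples, and the Helly property of K²(G). -/

section
variable {a b c x y z a' b' c' x' y' z' p q r u v w : V}

/-- Some complete set of cliques meets every clique of the clique graph that meets two of the three
given families. -/
def Cone (G : SimpleGraph V) (A₁ A₂ A₃ : Set (MaxClique G)) : Prop :=
  ∃ U, (cliqueGraph G).IsClique U ∧ ∀ B : MaxClique (cliqueGraph G),
    ((A₂ ∩ B.1).Nonempty ∧ (A₃ ∩ B.1).Nonempty) ∨ ((A₃ ∩ B.1).Nonempty ∧ (A₁ ∩ B.1).Nonempty) ∨
      ((A₁ ∩ B.1).Nonempty ∧ (A₂ ∩ B.1).Nonempty) → (U ∩ B.1).Nonempty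

variable {A₁ A₂ A₃ : Set (MaxClique G)}

theorem Cone.rot (h : Cone G A₁ A₂ A₃) : Cone G A₂ A₃ A₁ :=
  h.imp fun _ hU => ⟨hU.1, fun B hB => hU.2 B (by tauto)⟩

theorem Cone.swap (h : Cone G A₁ A₂ A₃) : Cone G A₁ A₃ A₂ :=
  h.imp fun _ hU => ⟨hU.1, fun B hB => hU.2 B (by tauto)⟩

theorem cone_of_twin (hA : (cliqueGraph G).IsClique A₁) (h : Twin G A₁ A₂) : Cone G A₁ A₂ A₃ :=
  ⟨A₁, hA, fun B hB => by have := h B; tauto⟩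

theorem Inner.mem_hull (h : Inner G a b c x y z) (hv : v = a ∨ v = b ∨ v = c)
    (hu : v = u ∨ G.Adj v u) : u ∈ hull a b c x y z := by
  have := h.adj_a u
  have := h.adj_b u
  have := h.adj_c u
  simp only [hull, Set.mem_ofPred_eq]
  grind

/-- Each triangle vertex dominates the whole hull except its antipode, and two vertices can be
antipodes of at most two of the three. -/
theorem Inner.exists_common (h : Inner G a b c x y z) (hu : u ∈ hull a b c x y z)
    (hv : v ∈ hull a b c x y z) : ∃ t, (t = a ∨ t = b ∨ t = c) ∧ (t = u ∨ G.Adj t u) ∧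
      (t = v ∨ G.Adj t v) := by
  have ha := h.adj_a
  have hb := h.adj_b
  have hc := h.adj_c
  by_cases h1 : u ≠ x ∧ v ≠ x
  · refine ⟨a, .inl rfl, ?_, ?_⟩ <;> simp only [hull, Set.mem_ofPred_eq] at hu hv <;> grind
  by_cases h2 : u ≠ y ∧ v ≠ y
  · refine ⟨b, .inr (.inl rfl), ?_, ?_⟩ <;> simp only [hull, Set.mem_ofPred_eq] at hu hv <;> grind
  · have := h.ne_xy
    have := hc u
    have := hc v
    refine ⟨c, .inr (.inr rfl), ?_, ?_⟩ <;> simp only [hull, Set.mem_ofPred_eq] at hu hv <;> grind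

/-- Inner triangles opposite at two different vertices would make `x y z` complete, so only one
opposite necktie is possible. -/
theorem twin_of_opposite (hO : OctahedronFree G) (h : Inner G a b c x y z)
    (h₂ : Opposite G a b c x y A₂)
    (h₃ : Opposite G a b c x y A₃ ∨ Opposite G b c a y z A₃ ∨ Opposite G c a b z x A₃) :
    Twin G A₂ A₃ := by
  obtain ⟨p, k, rfl⟩ := h₂
  obtain ⟨i1, i2, i3, i4, i5, i6, i7, i8, i9⟩ := h.adjs
  obtain ⟨j1, j2, j3, j4, j5, j6, j7, j8, j9⟩ := k.adjs
  have hzp : z ≠ p := fun e => hO h ⟨j2, e ▸ j5, e ▸ j4.symm⟩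
  rcases h₃ with ⟨p', -, rfl⟩ | ⟨p', k', -⟩ | ⟨p', k', -⟩
  · exact fun _ => Iff.rfl
  · rcases (k.adj_c z).1 k'.adjs.2.1 with e | e | e | e
    · exact absurd e.symm h.ne_c
    · exact absurd e h.ne_zx
    · exact absurd e hzp
    · exact absurd e.symm i8.ne
  · rcases (k.adj_b z).1 k'.adjs.2.1.symm with e | e | e | e
    · exact absurd e.symm h.ne_yz
    · exact absurd e.symm h.ne_c
    · exact absurd e.symm i9.ne
    · exact absurd e hzp

variable [Finite V]

theorem necktie_meet_star (h : Inner G a b c x y z) :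
    (necktie G a b c ∩ star G v).Nonempty ↔ v ∈ hull a b c x y z := by
  rw [Set.inter_comm, star_meet_necktie h]

theorem necktie_meet_opposite (hO : OctahedronFree G) (h : Inner G c x y p a b)
    (h' : Inner G a' b' c' x' y' z') (hx : x ∈ hull a' b' c' x' y' z' ∨ y ∈ hull a' b' c' x' y' z')
    (hm : (necktie G a b c ∩ necktie G a' b' c').Nonempty) :
    (necktie G c x y ∩ necktie G a' b' c').Nonempty := by
  obtain ⟨Q, hQ, hQ'⟩ := hm
  obtain ⟨i1, i2, i3, i4, i5, i6, i7, i8, i9⟩ := h.adjs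
  have mem := fun u => mem_hull_of_necktie (u := u) h' hQ'
  rcases hx with hx | hx
  · have : b ∈ Q.1 ∨ c ∈ Q.1 := by
      rcases hQ with h | h | h <;> tauto
    rcases this with hu | hu
    · exact necktie_meet_of_adj hO h h' (.inr (.inl rfl)) i9 hx (mem _ hu)
    · exact necktie_meet_of_adj hO h h' (.inr (.inl rfl)) i1.symm hx (mem _ hu)
  · have : a ∈ Q.1 ∨ c ∈ Q.1 := by
      rcases hQ with h | h | h <;> tauto
    rcases this with hu | hu
    · exact necktie_meet_of_adj hO h h' (.inr (.inr rfl)) i6 hx (mem _ hu)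
    · exact necktie_meet_of_adj hO h h' (.inr (.inr rfl)) i3 hx (mem _ hu)

variable [Nonempty V]

theorem cone_star_of_dominating (hG : DegreeLeFour G) (hO : OctahedronFree G)
    (hu : ∀ w, ((b = w ∨ G.Adj b w) ∧ (c = w ∨ G.Adj c w)) ∨
      ((c = w ∨ G.Adj c w) ∧ (a = w ∨ G.Adj a w)) ∨
      ((a = w ∨ G.Adj a w) ∧ (b = w ∨ G.Adj b w)) → u = w ∨ G.Adj u w) :
    Cone G (star G a) (star G b) (star G c) := by
  refine ⟨star G u, isClique_star u, fun B hB => ?_⟩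
  rcases eq_star_or_eq_necktie hG hO B with ⟨v, hv⟩ | ⟨a', b', c', x', y', z', hT, hv⟩
  · simp only [hv, star_meet_star] at hB ⊢
    exact hu v hB
  · simp only [hv, star_meet_necktie hT] at hB ⊢
    have key : ∀ {t s}, (t = s ∨ G.Adj t s) → (s = t ∨ G.Adj s t) :=
      fun h => h.imp Eq.symm fun h => h.symm
    have : ∃ t, (t = a' ∨ t = b' ∨ t = c') ∧ (u = t ∨ G.Adj u t) := by
      rcases hB with ⟨h1, h2⟩ | ⟨h1, h2⟩ | ⟨h1, h2⟩ <;>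
        obtain ⟨t, ht, h1, h2⟩ := hT.exists_common h1 h2
      · exact ⟨t, ht, hu t (.inl ⟨key h1, key h2⟩)⟩
      · exact ⟨t, ht, hu t (.inr (.inl ⟨key h1, key h2⟩))⟩
      · exact ⟨t, ht, hu t (.inr (.inr ⟨key h1, key h2⟩))⟩
    obtain ⟨t, ht, h⟩ := this
    exact hT.mem_hull ht (key h)

theorem cone_star_of_inner (hG : DegreeLeFour G) (hO : OctahedronFree G)
    (h : Inner G a b c x y z) : Cone G (star G a) (star G b) (star G c) := by
  refine ⟨necktie G a b c, isClique_necktie, fun B hB => ?_⟩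
  obtain ⟨i1, i2, i3, -⟩ := h.adjs
  rcases eq_star_or_eq_necktie hG hO B with ⟨v, hv⟩ | ⟨a', b', c', x', y', z', hT, hv⟩
  · simp only [hv, star_meet_star, necktie_meet_star h] at hB ⊢
    rcases hB with ⟨h1, h2⟩ | ⟨h1, h2⟩ | ⟨h1, h2⟩
    · exact h.mem_hull (by tauto) h1
    · exact h.mem_hull (by tauto) h1
    · exact h.mem_hull (by tauto) h1
  · simp only [hv, star_meet_necktie hT] at hB ⊢
    rcases hB with ⟨h1, h2⟩ | ⟨h1, h2⟩ | ⟨h1, h2⟩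
    · exact necktie_meet_of_adj hO h hT (by tauto) i2 h1 h2
    · exact necktie_meet_of_adj hO h hT (by tauto) i3 h1 h2
    · exact necktie_meet_of_adj hO h hT (by tauto) i1 h1 h2

theorem cone_star_star_star (hG : DegreeLeFour G) (hO : OctahedronFree G)
    (hbc : (star G b ∩ star G c).Nonempty) (hca : (star G c ∩ star G a).Nonempty)
    (hab : (star G a ∩ star G b).Nonempty) : Cone G (star G a) (star G b) (star G c) := by
  rw [star_meet_star] at hbc hca hab
  rcases hab with rfl | hab
  · exact cone_of_twin (isClique_star _) fun _ => Iff.rfl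
  rcases hbc with rfl | hbc
  · exact (cone_of_twin (isClique_star _) fun _ => Iff.rfl).rot.rot
  rcases hca with rfl | hca
  · exact (cone_of_twin (isClique_star _) fun _ => Iff.rfl).rot
  by_contra hcon
  -- If none of `a`, `b`, `c` dominates, the failures supply `x`, `y`, `z`, and the triangle is
  -- inner.
  have key := fun u => mt (cone_star_of_dominating (a := a) (b := b) (c := c) (u := u) hG hO) hcon
  push Not at key
  obtain ⟨x, hx⟩ := key a
  obtain ⟨y, hy⟩ := key b
  obtain ⟨z, hz⟩ := key c
  have hs := G.adj_comm
  exact hcon (cone_star_of_inner hG hO (hG.inner (x := x) (y := y) (z := z) hab hbc hca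
    (by grind) (by grind) (by grind) (by grind) (by grind) (by grind) (by grind) (by grind)
    (by grind) (by grind) (by grind) (by grind)))

theorem cone_star_star_of_mem (hG : DegreeLeFour G) (hO : OctahedronFree G)
    (h : Inner G a b c x y z) (hv : v = a ∨ v = b ∨ v = c) (hvw : G.Adj v w) :
    Cone G (star G v) (star G w) (necktie G a b c) := by
  refine ⟨necktie G a b c, isClique_necktie, fun B hB => ?_⟩
  rcases eq_star_or_eq_necktie hG hO B with ⟨u, hu⟩ | ⟨a', b', c', x', y', z', hT, hu⟩
  · simp only [hu, star_meet_star, necktie_meet_star h] at hB ⊢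
    rcases hB with hB | hB | hB
    · exact hB.2
    · exact hB.1
    · exact h.mem_hull hv hB.1
  · simp only [hu, star_meet_necktie hT] at hB ⊢
    rcases hB with hB | hB | hB
    · exact hB.2
    · exact hB.1
    · exact necktie_meet_of_adj hO h hT hv hvw hB.1 hB.2

/-- If some common neighbour `p` of `x` and `y` is neither `c` nor adjacent to `c`, then `c x y` is
inner and its necktie serves. Otherwise `c` dominates all common neighbours, and the necktie of `a b
c` serves. -/
theorem cone_star_star_of_outer (hG : DegreeLeFour G) (hO : OctahedronFree G)
    (h : Inner G a b c x y z) (hxy : G.Adj x y) :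
    Cone G (star G x) (star G y) (necktie G a b c) := by
  obtain ⟨i1, i2, i3, i4, i5, i6, i7, i8, i9⟩ := h.adjs
  by_cases hp : ∃ p, G.Adj p x ∧ G.Adj p y ∧ p ≠ c ∧ ¬ G.Adj p c
  · obtain ⟨p, hpx, hpy, hpc, hpc'⟩ := hp
    have k : Inner G c x y p a b := hG.inner i5 hxy i6.symm hpx hpy i7 i3.symm i2 i4 hpc'
      h.not_adj h.rot.not_adj hpc h.ne_a h.ne_b
    refine ⟨necktie G c x y, isClique_necktie, fun B hB => ?_⟩
    rcases eq_star_or_eq_necktie hG hO B with ⟨u, hu⟩ | ⟨a', b', c', x', y', z', hT, hu⟩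
    · simp only [hu, star_meet_star, necktie_meet_star h, necktie_meet_star k] at hB ⊢
      rcases hB with hB | hB | hB
      · exact k.mem_hull (.inr (.inr rfl)) hB.1
      · exact k.mem_hull (.inr (.inl rfl)) hB.2
      · exact k.mem_hull (.inr (.inl rfl)) hB.1
    · simp only [hu, star_meet_necktie hT] at hB ⊢
      rcases hB with hB | hB | hB
      · exact necktie_meet_opposite hO k hT (.inr hB.1) hB.2
      · exact necktie_meet_opposite hO k hT (.inl hB.2) hB.1
      · exact necktie_meet_of_adj hO k hT (.inr (.inl rfl)) hxy hB.1 hB.2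
  · push Not at hp
    have dom : ∀ t, (t = x ∨ G.Adj t x) → (t = y ∨ G.Adj t y) → t = c ∨ G.Adj t c := by
      intro t h1 h2
      rcases h1 with rfl | h1
      · exact .inr i5.symm
      rcases h2 with rfl | h2
      · exact .inr i6.symm
      exact or_iff_not_imp_left.2 fun e => hp t h1 h2 e
    refine ⟨necktie G a b c, isClique_necktie, fun B hB => ?_⟩
    rcases eq_star_or_eq_necktie hG hO B with ⟨u, hu⟩ | ⟨a', b', c', x', y', z', hT, hu⟩
    · simp only [hu, star_meet_star, necktie_meet_star h] at hB ⊢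
      have key : ∀ {t s}, (t = s ∨ G.Adj t s) → (s = t ∨ G.Adj s t) :=
        fun h => h.imp Eq.symm fun h => h.symm
      rcases hB with hB | hB | ⟨h1, h2⟩
      · exact hB.2
      · exact hB.1
      · exact h.mem_hull (.inr (.inr rfl)) (key (dom u (key h1) (key h2)))
    · simp only [hu, star_meet_necktie hT] at hB ⊢
      rcases hB with hB | hB | ⟨h1, h2⟩
      · exact hB.2
      · exact hB.1
      · obtain ⟨t, ht, k1, k2⟩ := hT.exists_common h1 h2
        exact necktie_meet_of_adj hO h hT (.inr (.inr rfl)) i5 (hT.mem_hull ht (dom t k1 k2)) h1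

theorem cone_star_star_necktie (hG : DegreeLeFour G) (hO : OctahedronFree G)
    (h : Inner G a b c x y z) (hvw : (star G v ∩ star G w).Nonempty)
    (hv : (star G v ∩ necktie G a b c).Nonempty) (hw : (star G w ∩ necktie G a b c).Nonempty) :
    Cone G (star G v) (star G w) (necktie G a b c) := by
  rw [star_meet_star] at hvw
  rcases hvw with rfl | hvw
  · exact cone_of_twin (isClique_star _) fun _ => Iff.rfl
  rw [star_meet_necktie h] at hv hw
  by_cases h1 : v = a ∨ v = b ∨ v = c
  · exact cone_star_star_of_mem hG hO h h1 hvw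
  by_cases h2 : w = a ∨ w = b ∨ w = c
  · exact (cone_star_star_of_mem hG hO h h2 hvw.symm).swap.rot.rot
  have hv : v = x ∨ v = y ∨ v = z := by simp only [hull, Set.mem_ofPred_eq] at hv; tauto
  have hw : w = x ∨ w = y ∨ w = z := by simp only [hull, Set.mem_ofPred_eq] at hw; tauto
  have main : ∀ {a b c x y z : V}, Inner G a b c x y z → G.Adj x y →
      Cone G (star G x) (star G y) (necktie G a b c) ∧
      Cone G (star G y) (star G x) (necktie G a b c) := fun h hxy =>
    ⟨cone_star_star_of_outer hG hO h hxy, (cone_star_star_of_outer hG hO h hxy).swap.rot.rot⟩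
  have m1 := main h
  have m2 := main h.rot
  have m3 := main h.rot.rot
  rw [necktie_rot] at m2
  rw [necktie_rot, necktie_rot] at m3
  rcases hv with rfl | rfl | rfl <;> rcases hw with rfl | rfl | rfl
  · exact absurd rfl hvw.ne
  · exact (m1 hvw).1
  · exact (m3 hvw.symm).2
  · exact (m1 hvw.symm).2
  · exact absurd rfl hvw.ne
  · exact (m2 hvw).1
  · exact (m3 hvw).1
  · exact (m2 hvw.symm).2
  · exact absurd rfl hvw.ne

theorem cone_star_of_opposite (hG : DegreeLeFour G) (hO : OctahedronFree G)
    (h : Inner G a b c x y z) (h' : Inner G c x y p a b) (hv : v = a ∨ v = b ∨ v = c) :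
    Cone G (star G v) (necktie G a b c) (necktie G c x y) := by
  obtain ⟨i1, i2, i3, i4, i5, i6, i7, i8, i9⟩ := h.adjs
  refine ⟨necktie G a b c, isClique_necktie, fun B hB => ?_⟩
  rcases eq_star_or_eq_necktie hG hO B with ⟨u, hu⟩ | ⟨a', b', c', x', y', z', hT, hu⟩
  · simp only [hu, star_meet_star, necktie_meet_star h] at hB ⊢
    rcases hB with hB | hB | hB
    · exact hB.1
    · exact h.mem_hull hv hB.2
    · exact hB.2
  · simp only [hu, star_meet_necktie hT] at hB ⊢
    rcases hB with hB | ⟨⟨Q, hQ, hQ'⟩, hB⟩ | hB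
    · exact hB.1
    · have mem := fun u => mem_hull_of_necktie (u := u) hT hQ'
      have hQ : (x ∈ Q.1 ∧ y ∈ Q.1) ∨ (y ∈ Q.1 ∧ c ∈ Q.1) ∨ (c ∈ Q.1 ∧ x ∈ Q.1) := hQ
      have : ∃ w ∈ Q.1, G.Adj v w := by
        rcases hv with rfl | rfl | rfl
        · have : c ∈ Q.1 ∨ y ∈ Q.1 := by tauto
          exact this.elim (fun h => ⟨c, h, i3.symm⟩) fun h => ⟨y, h, i7⟩
        · have : c ∈ Q.1 ∨ x ∈ Q.1 := by tauto
          exact this.elim (fun h => ⟨c, h, i2⟩) fun h => ⟨x, h, i4⟩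
        · have : x ∈ Q.1 ∨ y ∈ Q.1 := by tauto
          exact this.elim (fun h => ⟨x, h, i5⟩) fun h => ⟨y, h, i6⟩
      obtain ⟨w, hw, hvw⟩ := this
      exact necktie_meet_of_adj hO h hT hv hvw hB (mem w hw)
    · exact hB.2

theorem cone_star_necktie_necktie (hG : DegreeLeFour G) (hO : OctahedronFree G)
    (h : Inner G a b c x y z) (h' : Inner G a' b' c' x' y' z')
    (hv : (star G v ∩ necktie G a b c).Nonempty) (hv' : (star G v ∩ necktie G a' b' c').Nonempty)
    (hm : (necktie G a b c ∩ necktie G a' b' c').Nonempty) :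
    Cone G (star G v) (necktie G a b c) (necktie G a' b' c') := by
  have main : ∀ {a b c x y z : V} {A : Set (MaxClique G)}, Inner G a b c x y z →
      (star G v ∩ necktie G a b c).Nonempty → (star G v ∩ A).Nonempty →
      Opposite G a b c x y A → Cone G (star G v) (necktie G a b c) A := by
    rintro a b c x y z _ h hv hv' ⟨p, k, rfl⟩
    rw [star_meet_necktie h] at hv
    rw [star_meet_necktie k] at hv'
    obtain ⟨i1, i2, i3, i4, i5, i6, i7, i8, i9⟩ := h.adjs
    obtain ⟨j1, j2, j3, j4, j5, j6, j7, j8, j9⟩ := k.adjs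
    by_cases h1 : v = a ∨ v = b ∨ v = c
    · exact cone_star_of_opposite hG hO h k h1
    by_cases h2 : v = x ∨ v = y ∨ v = c
    · have := cone_star_of_opposite hG hO k.rot h.rot.rot h2
      rw [necktie_rot (a := c) (b := x), necktie_rot (a := b) (b := c),
        necktie_rot (a := a) (b := b)] at this
      exact this.swap
    -- The one vertex left in each hull is the outer one, so `z = p` and the outer face would be
    -- complete.
    · simp only [hull, Set.mem_ofPred_eq] at hv hv'
      have e1 : v = z := by tauto
      have e2 : v = p := by tauto
      have e : p = z := e2.symm.trans e1
      exact absurd ⟨j2, e ▸ j5, e ▸ j4.symm⟩ (hO h)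
  rcases twin_or_opposite hG hO h h' hm with ht | ht | ht | ht
  · exact (cone_of_twin isClique_necktie ht).rot.rot
  · exact main h hv hv' ht
  · have := main h.rot (by rwa [necktie_rot]) hv' ht
    rwa [necktie_rot] at this
  · have := main h.rot.rot (by rwa [necktie_rot, necktie_rot]) hv' ht
    rwa [necktie_rot, necktie_rot] at this

/-- Unless one of `A₂`, `A₃` is a twin of the first necktie, both are opposite to it and hence twins
of each other. -/
theorem cone_necktie_necktie_necktie (hG : DegreeLeFour G) (hO : OctahedronFree G)
    (h : Inner G a b c x y z) (h₂ : ∃ a b c x y z, Inner G a b c x y z ∧ A₂ = necktie G a b c)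
    (h₃ : ∃ a b c x y z, Inner G a b c x y z ∧ A₃ = necktie G a b c)
    (hm₂ : (necktie G a b c ∩ A₂).Nonempty) (hm₃ : (necktie G a b c ∩ A₃).Nonempty) :
    Cone G (necktie G a b c) A₂ A₃ := by
  obtain ⟨a₂, b₂, c₂, x₂, y₂, z₂, k₂, rfl⟩ := h₂
  obtain ⟨a₃, b₃, c₃, x₃, y₃, z₃, k₃, rfl⟩ := h₃
  rcases twin_or_opposite hG hO h k₂ hm₂ with h₂ | h₂
  · exact cone_of_twin isClique_necktie h₂
  rcases twin_or_opposite hG hO h k₃ hm₃ with h₃ | h₃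
  · exact (cone_of_twin isClique_necktie h₃).swap
  refine (cone_of_twin isClique_necktie ?_).rot.rot
  rcases h₂ with h₂ | h₂ | h₂
  · exact twin_of_opposite hO h h₂ h₃
  · exact twin_of_opposite hO h.rot h₂ (by tauto)
  · exact twin_of_opposite hO h.rot.rot h₂ (by tauto)

theorem cone_of_meet (hG : DegreeLeFour G) (hO : OctahedronFree G)
    (A B C : MaxClique (cliqueGraph G)) (hBC : (B.1 ∩ C.1).Nonempty) (hCA : (C.1 ∩ A.1).Nonempty)
    (hAB : (A.1 ∩ B.1).Nonempty) : Cone G A.1 B.1 C.1 := by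
  rcases eq_star_or_eq_necktie hG hO A with ⟨u, hA⟩ | ⟨a₁, b₁, c₁, x₁, y₁, z₁, k₁, hA⟩ <;>
  rcases eq_star_or_eq_necktie hG hO B with ⟨v, hB⟩ | ⟨a₂, b₂, c₂, x₂, y₂, z₂, k₂, hB⟩ <;>
  rcases eq_star_or_eq_necktie hG hO C with ⟨w, hC⟩ | ⟨a₃, b₃, c₃, x₃, y₃, z₃, k₃, hC⟩ <;>
  rw [hA, hB] at hAB <;> rw [hB, hC] at hBC <;> rw [hC, hA] at hCA <;> rw [hA, hB, hC]
  · exact cone_star_star_star hG hO hBC hCA hAB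
  · exact cone_star_star_necktie hG hO k₃ hAB (Set.inter_comm _ _ ▸ hCA) hBC
  · exact (cone_star_star_necktie hG hO k₂ (Set.inter_comm _ _ ▸ hCA) hAB (Set.inter_comm _ _ ▸ hBC)).swap
  · exact cone_star_necktie_necktie hG hO k₂ k₃ hAB (Set.inter_comm _ _ ▸ hCA) hBC
  · exact (cone_star_star_necktie hG hO k₁ hBC (Set.inter_comm _ _ ▸ hAB) hCA).rot.rot
  · exact (cone_star_necktie_necktie hG hO k₃ k₁ hBC (Set.inter_comm _ _ ▸ hAB) hCA).rot.rot
  · exact (cone_star_necktie_necktie hG hO k₁ k₂ hCA (Set.inter_comm _ _ ▸ hBC) hAB).rot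
  · exact cone_necktie_necktie_necktie hG hO k₁ ⟨_, _, _, _, _, _, k₂, rfl⟩
      ⟨_, _, _, _, _, _, k₃, rfl⟩ hAB (Set.inter_comm _ _ ▸ hCA)

theorem helly_cliqueGraph_cliqueGraph (hG : DegreeLeFour G) (hO : OctahedronFree G) :
    Helly (cliqueGraph (cliqueGraph G)) := by
  intro F hne hF
  refine exists_common_maxClique F hne hF fun A B C hBC hCA hAB => ?_
  obtain ⟨U, hU, hU'⟩ := cone_of_meet hG hO A B C hBC.2 hCA.2 hAB.2
  obtain ⟨D, hD⟩ := exists_maxClique hU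
  -- `D` extends the cone `U`. Every `E` in `q` meets two of `A`, `B`, `C`, hence meets `D`, so
  -- maximality puts `D` in `q`.
  refine ⟨D, fun q _ hq => MaxClique.mem_of_forall q fun E hE => ?_⟩
  have meet : ∀ {X}, X ∈ q.1 → (X.1 ∩ E.1).Nonempty := fun hX => meet_of_isClique q hX hE
  have : (U ∩ E.1).Nonempty := hU' E (by
    rcases hq with ⟨h1, h2⟩ | ⟨h1, h2⟩ | ⟨h1, h2⟩
    · exact .inl ⟨meet h1, meet h2⟩
    · exact .inr (.inl ⟨meet h1, meet h2⟩)
    · exact .inr (.inr ⟨meet h1, meet h2⟩))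
  exact or_iff_not_imp_left.2 fun hne => ⟨hne, this.mono (Set.inter_subset_inter_left _ hD)⟩

end

/-! ### A complete octahedron is the whole connected graph. -/

theorem Inner.iso_octahedronGraph {a b c x y z : V} (hG : DegreeLeFour G) (hconn : G.Connected)
    (h : Inner G a b c x y z) (hxy : G.Adj x y) (hyz : G.Adj y z) (hzx : G.Adj z x) :
    Nonempty (G ≃g octahedronGraph) := by
  classical
  obtain ⟨i1, i2, i3, i4, i5, i6, i7, i8, i9⟩ := h.adjs
  -- The outer vertices now have four neighbours as well, so the hull is closed under adjacency.
  have hx := hG i4.symm i5.symm hxy hzx.symm i2.ne h.ne_b i9.ne i6.ne h.ne_c hyz.ne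
  have hy := hG i7.symm i6.symm hxy.symm hyz i3.ne.symm h.ne_a i8.ne i5.ne h.ne_c hzx.ne.symm
  have hz := hG i8.symm i9.symm hzx hyz.symm i1.ne h.ne_a i7.ne i4.ne h.ne_b hxy.ne
  have hull_adj : ∀ u v, G.Adj u v → u ∈ hull a b c x y z → v ∈ hull a b c x y z := by
    intro u v huv hu
    rcases hu with rfl | rfl | rfl | rfl | rfl | rfl
    · have := (h.adj_a v).1 huv
      unfold hull; simp only [Set.mem_ofPred_eq]; tauto
    · have := (h.adj_b v).1 huv
      unfold hull; simp only [Set.mem_ofPred_eq]; tauto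
    · have := (h.adj_c v).1 huv
      unfold hull; simp only [Set.mem_ofPred_eq]; tauto
    · have := (hx v).1 huv
      unfold hull; simp only [Set.mem_ofPred_eq]; tauto
    · have := (hy v).1 huv
      unfold hull; simp only [Set.mem_ofPred_eq]; tauto
    · have := (hz v).1 huv
      unfold hull; simp only [Set.mem_ofPred_eq]; tauto
  have hall : ∀ v, v ∈ hull a b c x y z := by
    intro v
    obtain ⟨p⟩ := hconn a v
    have : ∀ {u w} (p : G.Walk u w), u ∈ hull a b c x y z → w ∈ hull a b c x y z := by
      intro u w p
      induction p with
      | nil => exact id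
      | cons e p ih => exact fun hu => ih (hull_adj _ _ e hu)
    exact this p (.inl rfl)
  let f : Fin 3 × Fin 2 → V := fun p => ![![a, x], ![b, y], ![c, z]] p.1 p.2
  have hadj : ∀ p q, G.Adj (f p) (f q) ↔ octahedronGraph.Adj p q := by
    have e1 := h.not_adj
    have e2 := h.rot.not_adj
    have e3 := h.rot.rot.not_adj
    rintro ⟨i, j⟩ ⟨k, l⟩
    fin_cases i <;> fin_cases j <;> fin_cases k <;> fin_cases l <;>
      simp [f, octahedronGraph, *, i1.symm, i2.symm, i3.symm, i4.symm, i5.symm, i6.symm, i7.symm,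
        i8.symm, i9.symm, hxy.symm, hyz.symm, hzx.symm, G.adj_comm x a, G.adj_comm y b,
        G.adj_comm z c]
  have hinj : Function.Injective f := by
    intro p q hpq
    have hn : ¬ octahedronGraph.Adj p q := fun e => ((hadj p q).2 e).ne hpq
    obtain ⟨i, j⟩ := p
    obtain ⟨k, l⟩ := q
    obtain rfl : i = k := not_not.1 hn
    have := h.ne_a
    have := h.ne_b
    have := h.ne_c
    fin_cases i <;> fin_cases j <;> fin_cases l <;> simp_all [f]
  have hsurj : Function.Surjective f := by
    intro v
    rcases hall v with rfl | rfl | rfl | rfl | rfl | rfl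
    exacts [⟨(0, 0), rfl⟩, ⟨(1, 0), rfl⟩, ⟨(2, 0), rfl⟩, ⟨(0, 1), rfl⟩, ⟨(1, 1), rfl⟩, ⟨(2, 1), rfl⟩]
  exact ⟨(⟨Equiv.ofBijective f ⟨hinj, hsurj⟩, hadj _ _⟩ : octahedronGraph ≃g G).symm⟩

theorem octahedronFree_of_connected (hG : DegreeLeFour G) (hconn : G.Connected)
    (hoct : ¬ Nonempty (G ≃g octahedronGraph)) : OctahedronFree G :=
  fun _ _ _ _ _ _ h ⟨hxy, hyz, hzx⟩ => hoct (h.iso_octahedronGraph hG hconn hxy hyz hzx)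

end LowDegree

theorem mainTheorem1 {V : Type u} [Fintype V] (G : SimpleGraph V) [DecidableRel G.Adj]
    (hconn : G.Connected) (hoct : ¬ Nonempty (G ≃g octahedronGraph)) :
    (G.maxDegree ≤ 4 → CliqueConvergent G) ∧
      (CliqueDivergent G → ∃ v : V, 5 ≤ G.degree v) := by
  have main : G.maxDegree ≤ 4 → CliqueConvergent G := fun h => by
    have := hconn.nonempty
    have hG := LowDegree.degreeLeFour_of_maxDegree h
    have hH : LowDegree.Helly (iterCliqueGraph G 2).2 :=
      LowDegree.helly_cliqueGraph_cliqueGraph (G := G) hG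
        (LowDegree.octahedronFree_of_connected hG hconn hoct)
    exact LowDegree.cliqueConvergent_of_helly hH
  refine ⟨main, fun hdiv => ?_⟩
  by_contra hcon
  push Not at hcon
  exact hdiv (main (G.maxDegree_le_of_forall_degree_le 4 fun v => by have := hcon v; omega))
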